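/- Let $d\ge s\ge 1$ be integers and let $\mathbb{L}^d=(\mathbb{Z}^d,\mathbb{E}^d)$ be the hypercubic lattice, where $\mathbb{E}^d=\{\{x,y\}\subset\mathbb{Z}^d:\|x-y\|_1=1\}$. Put $H=\mathbb{Z}^s\times\{0\}^{d-s}$. For $(p,q)\in[0,1]^2$, let $P_{p,q}$ be the bond percolation measure on $\{0,1\}^{\mathbb{E}^d}$ under which the edges are open (state $1$) independently of each other, each edge with both endpoints in $H$ being open with probability $q$ and every other edge being open with probability $p$. Let $E_{p,q}$ be the corresponding expectation, and let $C$ be the cluster of the origin $o$, that is, the set of all $v\in\mathbb{Z}^d$ such that $v=o$ or $v$ is joined to $o$ by a path of open edges. Then the set $$\mathcal{A}=\{(p,q)\in[0,1]^2 : E_{p,q}|C|<\infty\}$$ is open in $[0,1]^2$, with respect to the subspace topology inherited from $\mathbb{R}^2$. -/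

import Mathlib

open MeasureTheory ProbabilityTheory
open scoped ENNReal unitInterval

noncomputable section

namespace DefectPercolation

/-- The hypercubic lattice on `ℤ^d`: two vertices are adjacent when their `ℓ¹` distance is `1`. -/
def lattice (d : ℕ) : SimpleGraph (Fin d → ℤ) where
  Adj x y := ∑ i, |x i - y i| = 1
  symm := ⟨fun x y h => by simpa only [abs_sub_comm] using h⟩
  loopless := ⟨fun x h => by simp at h⟩

/-- The edges of the hypercubic lattice. -/
abbrev Edge (d : ℕ) : Type := (lattice d).edgeSet

/-- Percolation configurations: `true` means open and `false` means closed.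
The σ-algebra is the product one, generated by finite-dimensional cylinders. -/
abbrev Config (d : ℕ) : Type := Edge d → Bool

/-- The sublattice `H = ℤ^s × {0}^(d-s)` of `ℤ^d`. -/
def sublattice (d s : ℕ) : Set (Fin d → ℤ) := {x | ∀ i : Fin d, s ≤ (i : ℕ) → x i = 0}

/-- The edges of the lattice with both endpoints in the sublattice `H`. -/
def sublatticeEdges (d s : ℕ) : Set (Edge d) :=
  {e | ∀ x ∈ (e : Sym2 (Fin d → ℤ)), x ∈ sublattice d s}

open Classical in
/-- The parameter of an edge: `q` inside the sublattice and `p` elsewhere. -/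
def edgeParam (d s : ℕ) (p q : I) (e : Edge d) : I :=
  if e ∈ sublatticeEdges d s then q else p

/-- The measure `P_{p,q}`: edges are independent, each open with its own parameter. -/
def percMeasure (d s : ℕ) (p q : I) : Measure (Config d) :=
  Measure.infinitePi fun e => bernoulliMeasure true false (edgeParam d s p q e)

/-- The graph on `ℤ^d` formed by the open edges of a configuration. -/
def openGraph {d : ℕ} (ω : Config d) : SimpleGraph (Fin d → ℤ) where
  Adj x y := ∃ h : (lattice d).Adj x y, ω ⟨s(x, y), h⟩ = true
  symm := ⟨fun x y ⟨h, hω⟩ => ⟨h.symm, by simpa only [Sym2.eq_swap] using hω⟩⟩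
  loopless := ⟨fun x ⟨h, _⟩ => (lattice d).loopless.irrefl x h⟩

/-- The cluster of `u`: all vertices joined to `u` by an open path (including `u`). -/
def cluster {d : ℕ} (ω : Config d) (u : Fin d → ℤ) : Set (Fin d → ℤ) :=
  {v | (openGraph ω).Reachable u v}

/-- The expected number of vertices of the cluster of the origin, a value in `[1, ∞]`. -/
def expectedClusterSize (d s : ℕ) (p q : I) : ℝ≥0∞ :=
  ∫⁻ ω, ((cluster ω 0).encard : ℝ≥0∞) ∂(percMeasure d s p q)

/-- The set of parameters `(p, q) ∈ [0,1]²` for which the expected cluster size is finite. -/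
def subcriticalSet (d s : ℕ) : Set (I × I) :=
  {x | expectedClusterSize d s x.1 x.2 < ∞}

end DefectPercolation

end

/-!
Sprinkling extra open edges with probabilities `ε` over a configuration with parameters `r` gives,
by exploring the cluster of `x` before the sprinkled edges, the inequality `meanSize_orProb_le`
`χ(x) ≤ χ_r(x) + ∑ₐ P_r(x ↔ a.fst) ε(a) χ(a.snd)`, where `χ` refers to the sprinkled configuration.
If `χ_r ≤ K` and the coefficients of `χ` sum to at most `δ < 1` at every vertex, then
`χ ≤ K / (1 - δ)`; passing through finitely many edges first makes `sup χ` finite a priori, so that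
it can be absorbed. With bounded degrees, a uniform bound on `χ_r` therefore survives a small
increase of all parameters.

So it suffices to bound the mean cluster size uniformly, given that it is finite at the origin. On
the sublattice `H` it is constant, by translation, which settles `s = d`. If `s < d`, consider
homogeneous percolation with parameter `p`: an edge leaving the box `[-n, n]^d` from the cluster of `0` inside the box can be moved, by a
symmetry of the lattice, so that its outer end is the origin and the box avoids `H`; the expected
numbers of such edges are thus summable over `n`, some box has fewer than one on average, and the
same inequality (this is the Simon–Hammersley criterion) bounds the mean size uniformly.
Finally, sprinkling the edges of `H` over the others transfers the bound to all vertices.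
-/

noncomputable section

namespace BondPercolation

section ProductMeasure

variable {ι : Type*} {X : ι → Type*} [∀ i, MeasurableSpace (X i)] {S T : Set ι}
  {A B : Set (∀ i, X i)}

theorem measurableSet_iSup_comap_eval_of_dependsOn (hA : MeasurableSet A)
    (hAS : DependsOn (· ∈ A) S) :
    MeasurableSet[⨆ i ∈ S, (inferInstance : MeasurableSpace (X i)).comap (Function.eval i)] A := by
  classical
  rcases A.eq_empty_or_nonempty with rfl | ⟨ω₀, -⟩
  · exact @MeasurableSet.empty _ (_)
  let resample : (∀ i, X i) → ∀ i, X i := fun ω => S.piecewise ω ω₀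
  have hpreimage : resample ⁻¹' A = A := by
    ext ω
    exact iff_of_eq (hAS fun i hi => Set.piecewise_eq_of_mem _ _ _ hi)
  rw [← hpreimage]
  refine @measurable_pi_lambda _ _ _ (_) _ _ (fun i => ?_) _ hA
  by_cases hi : i ∈ S
  · simp only [resample, Set.piecewise_eq_of_mem _ _ _ hi]
    exact (comap_measurable (Function.eval i)).mono (le_iSup₂ (f := fun i _ =>
      (inferInstance : MeasurableSpace (X i)).comap (Function.eval i)) i hi) le_rfl
  · simp only [resample, Set.piecewise_eq_of_notMem _ _ _ hi]
    exact measurable_const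

theorem infinitePi_inter_of_dependsOn (μ : ∀ i, Measure (X i)) [∀ i, IsProbabilityMeasure (μ i)]
    (hST : Disjoint S T) (hA : MeasurableSet A) (hB : MeasurableSet B)
    (hAS : DependsOn (· ∈ A) S) (hBT : DependsOn (· ∈ B) T) :
    Measure.infinitePi μ (A ∩ B) = Measure.infinitePi μ A * Measure.infinitePi μ B := by
  have hindep : iIndepFun (fun i (ω : ∀ i, X i) => ω i) (Measure.infinitePi μ) :=
    iIndepFun_infinitePi (X := fun _ x => x) fun _ => measurable_id
  exact (Indep_iff _ _ _).1
    (indep_iSup_of_disjoint (fun i => (measurable_pi_apply i).comap_le) hindep hST) A B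
    (measurableSet_iSup_comap_eval_of_dependsOn hA hAS)
    (measurableSet_iSup_comap_eval_of_dependsOn hB hBT)

theorem measurableSet_of_dependsOn_finset [∀ i, Countable (X i)]
    [∀ i, MeasurableSingletonClass (X i)] {F : Finset ι} (hAF : DependsOn (· ∈ A) F) :
    MeasurableSet A := by
  have hpreimage : A = F.restrict ⁻¹' (F.restrict '' A) := by
    refine (Set.subset_preimage_image _ _).antisymm ?_
    rintro ω ⟨ω', hω', h⟩
    exact (iff_of_eq (hAF fun i hi => congrFun h ⟨i, hi⟩)).1 hω'
  rw [hpreimage]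
  exact F.measurable_restrict (Set.to_countable _).measurableSet

end ProductMeasure

theorem dependsOn_mem_inter {ι : Type*} {X : ι → Type*} {S T : Set ι} {A B : Set (∀ i, X i)}
    (hAS : DependsOn (· ∈ A) S) (hBT : DependsOn (· ∈ B) T) :
    DependsOn (· ∈ A ∩ B) (S ∪ T) := fun _ _ h =>
  congrArg₂ And (hAS fun i hi => h i (.inl hi)) (hBT fun i hi => h i (.inr hi))

theorem dependsOn_comp_inl {ι : Type*} {A : Set (ι → Bool)} {S : Set ι} (hA : DependsOn (· ∈ A) S) :
    DependsOn (· ∈ {ζ : ι ⊕ ι → Bool | ζ ∘ Sum.inl ∈ A}) (Sum.inl '' S) := fun _ _ h =>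
  hA fun _ hi => h _ (Set.mem_image_of_mem _ hi)

theorem dependsOn_sup_inl_inr {ι : Type*} {A : Set (ι → Bool)} {S : Set ι}
    (hA : DependsOn (· ∈ A) S) :
    DependsOn (· ∈ {ζ : ι ⊕ ι → Bool | ζ ∘ Sum.inl ⊔ ζ ∘ Sum.inr ∈ A}) (Sum.elim id id ⁻¹' S) :=
  fun _ _ h => hA fun i hi => congrArg₂ max (h (.inl i) hi) (h (.inr i) hi)

section BernoulliProduct

variable {ι κ : Type*}

/-- The law of a family of independent bits, where bit `i` is `true` with probability `r i`. -/
def bernoulliProduct (r : ι → I) : Measure (ι → Bool) :=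
  Measure.infinitePi fun i => bernoulliMeasure true false (r i)

instance (r : ι → I) : IsProbabilityMeasure (bernoulliProduct r) := by
  unfold bernoulliProduct; infer_instance

theorem measurePreserving_comp_bernoulliProduct (r : ι → I) {f : κ → ι} (hf : f.Injective) :
    MeasurePreserving (· ∘ f) (bernoulliProduct r) (bernoulliProduct (r ∘ f)) :=
  ⟨by fun_prop, Measure.map_infinitePi_infinitePi_of_inj hf⟩

theorem bernoulliProduct_setOf_apply_eq_true (r : ι → I) (i : ι) :
    bernoulliProduct r {ω | ω i = true} = ENNReal.ofReal (r i) := by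
  calc bernoulliProduct r {ω | ω i = true}
      = (bernoulliProduct r).map (Function.eval i) {true} :=
        (Measure.map_apply (measurable_pi_apply (X := fun _ => Bool) i)
          (measurableSet_singleton true)).symm
    _ = bernoulliMeasure true false (r i) {true} := by
        rw [bernoulliProduct, Measure.infinitePi_map_eval]
    _ = ENNReal.ofReal (r i) := by
        rw [bernoulliMeasure_apply_of_mem_of_notMem _ (measurableSet_singleton true) rfl (by simp),
          ← unitInterval.coe_toNNReal, ENNReal.ofReal_coe_nnreal]

/-- The configuration `ω` with all bits outside of `S` set to `false`. -/
def mask (S : Set ι) (ω : ι → Bool) (i : ι) : Bool := by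
  classical exact if i ∈ S then ω i else false

theorem mask_of_mem {S : Set ι} {i : ι} (hi : i ∈ S) (ω : ι → Bool) : mask S ω i = ω i :=
  if_pos hi

theorem mask_of_notMem {S : Set ι} {i : ι} (hi : i ∉ S) (ω : ι → Bool) : mask S ω i = false :=
  if_neg hi

theorem mask_eq_true {S : Set ι} {ω : ι → Bool} {i : ι} :
    mask S ω i = true ↔ i ∈ S ∧ ω i = true := by
  by_cases hi : i ∈ S <;> simp [mask, hi]

theorem mask_le (S : Set ι) (ω : ι → Bool) : mask S ω ≤ ω := fun _ =>
  Bool.le_iff_imp.2 fun h => (mask_eq_true.1 h).2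

theorem mask_mono_left {S T : Set ι} (hST : S ⊆ T) (ω : ι → Bool) : mask S ω ≤ mask T ω :=
  fun _ => Bool.le_iff_imp.2 fun h =>
    mask_eq_true.2 ⟨hST (mask_eq_true.1 h).1, (mask_eq_true.1 h).2⟩

theorem dependsOn_mask (S : Set ι) : DependsOn (mask S) S := fun ω ω' h => by
  funext i
  by_cases hi : i ∈ S
  · rw [mask_of_mem hi, mask_of_mem hi, h i hi]
  · rw [mask_of_notMem hi, mask_of_notMem hi]

theorem measurable_mask (S : Set ι) : Measurable (mask S) := by
  refine measurable_pi_lambda _ fun i => ?_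
  by_cases hi : i ∈ S
  · simpa only [mask_of_mem hi] using measurable_pi_apply i
  · simpa only [mask_of_notMem hi] using measurable_const

theorem measurePreserving_mask (r : ι → I) (S : Set ι) :
    MeasurePreserving (mask S) (bernoulliProduct r) (bernoulliProduct (S.indicator r)) := by
  classical
  refine ⟨measurable_mask S,
    (Measure.infinitePi_map_pi (μ := fun i => bernoulliMeasure true false (r i))
      (f := fun i b => if i ∈ S then b else false) fun _ => measurable_of_finite _).trans ?_⟩
  unfold bernoulliProduct
  congr with i : 1
  by_cases hi : i ∈ S <;> simp [hi]

/-- The probability that at least one of two independent events of probabilities `a` and `b`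
occurs. -/
def orProb (a b : I) : I := σ (σ a * σ b)

theorem coe_orProb (a b : I) : (orProb a b : ℝ) = 1 - (1 - a) * (1 - b) := by
  simp [orProb]

theorem orProb_zero_left (a : I) : orProb 0 a = a := by simp [orProb]

theorem orProb_zero_right (a : I) : orProb a 0 = a := by simp [orProb]

theorem orProb_indicator_indicator_compl (S : Set ι) (r : ι → I) (i : ι) :
    orProb (S.indicator r i) (Sᶜ.indicator r i) = r i := by
  by_cases hi : i ∈ S <;> simp [hi, orProb_zero_left, orProb_zero_right]

theorem orProb_one_left (a : I) : orProb 1 a = 1 := by simp [orProb]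

theorem exists_orProb_eq {a b : I} (hab : a ≤ b) : ∃ c, orProb a c = b := by
  have hσ : (σ b : ℝ) ≤ σ a := unitInterval.symm_le_symm.2 hab
  refine ⟨σ ⟨σ b / σ a, unitInterval.div_mem (σ b).2.1 (σ a).2.1 hσ⟩, ?_⟩
  rw [orProb, unitInterval.symm_symm, ← unitInterval.symm_inj, unitInterval.symm_symm]
  refine Subtype.ext (mul_div_cancel_of_imp' fun ha => ?_)
  exact le_antisymm (ha ▸ hσ) (σ b).2.1

theorem setOf_le_orProb_mem_nhds (a : I) {c : I} (hc : 0 < c) : {b | b ≤ orProb a c} ∈ nhds a := by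
  rcases eq_or_ne a 1 with rfl | ha
  · simp only [orProb_one_left, unitInterval.le_one', Set.ofPred_true, Filter.univ_mem]
  · refine Iic_mem_nhds (show (a : ℝ) < orProb a c from ?_)
    have ha1 : 0 < 1 - (a : ℝ) :=
      sub_pos.2 (unitInterval.coe_lt_one.2 (unitInterval.lt_one_iff_ne_one.2 ha))
    have hc0 : (0 : ℝ) < c := hc
    rw [coe_orProb]
    linarith [mul_pos ha1 hc0]

theorem map_or_bernoulliProduct_bool (r : Bool → I) :
    (bernoulliProduct r).map (fun ω => ω false || ω true) =
      bernoulliMeasure true false (orProb (r false) (r true)) := by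
  have hmeas : Measurable fun ω : Bool → Bool => ω false || ω true := measurable_of_finite _
  have : IsProbabilityMeasure ((bernoulliProduct r).map fun ω => ω false || ω true) :=
    Measure.isProbabilityMeasure_map hmeas.aemeasurable
  have hfalse : (bernoulliProduct r).map (fun ω => ω false || ω true) {false} =
      bernoulliMeasure true false (orProb (r false) (r true)) {false} := by
    have hpre : (fun ω : Bool → Bool => ω false || ω true) ⁻¹' {false} = {fun _ => false} := by
      ext ω; simp [funext_iff]
    have hbit (a : I) : bernoulliMeasure true false a {false} = unitInterval.toNNReal (σ a) :=
      bernoulliMeasure_apply_of_notMem_of_mem a (measurableSet_singleton _) (by simp) rfl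
    rw [Measure.map_apply hmeas (measurableSet_singleton _), hpre, bernoulliProduct,
      Measure.infinitePi_singleton_of_fintype, Fintype.prod_bool, hbit, hbit, hbit, orProb,
      unitInterval.symm_symm, mul_comm]
    exact (ENNReal.coe_mul _ _).symm
  refine Measure.ext_of_singleton fun b => ?_
  cases b with
  | false => exact hfalse
  | true =>
    have hcompl : ({true} : Set Bool) = {false}ᶜ := (Bool.compl_singleton false).symm
    rw [hcompl, prob_compl_eq_one_sub (measurableSet_singleton _),
      prob_compl_eq_one_sub (measurableSet_singleton _), hfalse]

theorem measurePreserving_inl_bernoulliProduct (r ε : ι → I) :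
    MeasurePreserving (· ∘ Sum.inl) (bernoulliProduct (Sum.elim r ε)) (bernoulliProduct r) := by
  simpa only [Sum.elim_comp_inl] using
    measurePreserving_comp_bernoulliProduct (Sum.elim r ε) Sum.inl_injective

theorem measurePreserving_sup_bernoulliProduct (r ε : ι → I) :
    MeasurePreserving (fun ζ => ζ ∘ Sum.inl ⊔ ζ ∘ Sum.inr) (bernoulliProduct (Sum.elim r ε))
      (bernoulliProduct fun i => orProb (r i) (ε i)) := by
  let f : ι × Bool → ι ⊕ ι := fun p => bif p.2 then .inr p.1 else .inl p.1
  have hf : f.Injective := by rintro ⟨i, _ | _⟩ ⟨j, _ | _⟩ <;> simp [f]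
  have hcurry : MeasurePreserving (MeasurableEquiv.curry ι Bool Bool)
      (bernoulliProduct (Sum.elim r ε ∘ f))
      (Measure.infinitePi fun i => bernoulliProduct fun b => Sum.elim r ε (f (i, b))) :=
    ⟨by fun_prop, Measure.infinitePi_map_curry fun i b =>
      bernoulliMeasure true false (Sum.elim r ε (f (i, b)))⟩
  have hor : MeasurePreserving (fun (ω : ι → Bool → Bool) i => ω i false || ω i true)
      (Measure.infinitePi fun i => bernoulliProduct fun b => Sum.elim r ε (f (i, b)))
      (bernoulliProduct fun i => orProb (r i) (ε i)) := by
    refine ⟨by fun_prop, (Measure.infinitePi_map_pi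
      (μ := fun i => bernoulliProduct fun b => Sum.elim r ε (f (i, b)))
      (f := fun _ ω => ω false || ω true) fun _ => measurable_of_finite _).trans ?_⟩
    simp only [map_or_bernoulliProduct_bool]
    rfl
  exact hor.comp (hcurry.comp (measurePreserving_comp_bernoulliProduct _ hf))

end BernoulliProduct

section OpenCluster

variable {V : Type*} {G : SimpleGraph V} {ω ω' : G.edgeSet → Bool} {x y : V}

/-- The graph formed by the open edges of a percolation configuration `ω` on the edges of `G`. -/
def openSubgraph (ω : G.edgeSet → Bool) : SimpleGraph V where
  Adj x y := ∃ h : G.Adj x y, ω ⟨s(x, y), h⟩ = true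
  symm := ⟨fun _ _ ⟨h, hω⟩ => ⟨h.symm, by simpa only [Sym2.eq_swap] using hω⟩⟩
  loopless := ⟨fun _ ⟨h, _⟩ => G.loopless.irrefl _ h⟩

/-- The open cluster of `x`: the vertices joined to `x` by open edges, including `x` itself. -/
def openCluster (ω : G.edgeSet → Bool) (x : V) : Set V := {y | (openSubgraph ω).Reachable x y}

/-- The edge of `G` underlying a dart, as an index of configurations. -/
def dartEdge (a : G.Dart) : G.edgeSet := ⟨a.edge, a.edge_mem⟩

theorem mem_dartEdge {a : G.Dart} {v : V} : v ∈ (dartEdge a : Sym2 V) ↔ v = a.fst ∨ v = a.snd :=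
  Sym2.mem_iff

theorem self_mem_openCluster (ω : G.edgeSet → Bool) (x : V) : x ∈ openCluster ω x :=
  SimpleGraph.Reachable.refl x

theorem snd_mem_openCluster {a : G.Dart} (ha : a.fst ∈ openCluster ω x)
    (hω : ω (dartEdge a) = true) : a.snd ∈ openCluster ω x :=
  SimpleGraph.Reachable.trans ha (SimpleGraph.Adj.reachable ⟨a.adj, hω⟩)

theorem mem_openCluster_comm : y ∈ openCluster ω x ↔ x ∈ openCluster ω y :=
  SimpleGraph.reachable_comm

theorem openSubgraph_mono (h : ω ≤ ω') : openSubgraph ω ≤ openSubgraph ω' :=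
  fun _ _ ⟨hadj, hω⟩ => ⟨hadj, Bool.le_iff_imp.1 (h _) hω⟩

theorem openCluster_mono (h : ω ≤ ω') (x : V) : openCluster ω x ⊆ openCluster ω' x :=
  fun _ hy => SimpleGraph.Reachable.mono (openSubgraph_mono h) hy

theorem openCluster_induction {P : V → Prop} (base : P x)
    (step : ∀ a : G.Dart, ω (dartEdge a) = true → a.fst ∈ openCluster ω x → P a.fst → P a.snd)
    (hy : y ∈ openCluster ω x) : P y := by
  induction (SimpleGraph.reachable_iff_reflTransGen x y).1 hy with
  | refl => exact base
  | @tail u v hxu huv ih =>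
    obtain ⟨hadj, hω⟩ := huv
    have hu : u ∈ openCluster ω x := (SimpleGraph.reachable_iff_reflTransGen x u).2 hxu
    exact step ⟨(u, v), hadj⟩ hω hu (ih hu)

theorem exists_finset_mem_openCluster_mask (hy : y ∈ openCluster ω x) :
    ∃ F : Finset G.edgeSet, y ∈ openCluster (mask F ω) x := by
  classical
  refine openCluster_induction (P := fun y => ∃ F : Finset G.edgeSet, y ∈ openCluster (mask F ω) x)
    ⟨∅, self_mem_openCluster _ _⟩ ?_ hy
  rintro a hω - ⟨F, hF⟩
  refine ⟨insert (dartEdge a) F, snd_mem_openCluster (openCluster_mono ?_ x hF) ?_⟩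
  · exact mask_mono_left (Finset.coe_subset.2 (Finset.subset_insert _ _)) ω
  · exact mask_eq_true.2 ⟨Finset.mem_insert_self _ _, hω⟩

theorem setOf_mem_openCluster_eq_iUnion (x y : V) :
    {ω : G.edgeSet → Bool | y ∈ openCluster ω x} =
      ⋃ F : Finset G.edgeSet, {ω | y ∈ openCluster (mask F ω) x} := by
  ext ω
  simp only [Set.mem_ofPred_eq, Set.mem_iUnion]
  exact ⟨exists_finset_mem_openCluster_mask, fun ⟨F, h⟩ => openCluster_mono (mask_le F ω) x h⟩

theorem dependsOn_mem_openCluster_mask (S : Set G.edgeSet) (x y : V) :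
    DependsOn (· ∈ {ω : G.edgeSet → Bool | y ∈ openCluster (mask S ω) x}) S := fun ω ω' h => by
  simp only [Set.mem_ofPred_eq, dependsOn_mask S h]

theorem measurableSet_setOf_mem_openCluster [Countable G.edgeSet] (x y : V) :
    MeasurableSet {ω : G.edgeSet → Bool | y ∈ openCluster ω x} := by
  rw [setOf_mem_openCluster_eq_iUnion]
  exact .iUnion fun F => measurableSet_of_dependsOn_finset
    (dependsOn_mem_openCluster_mask (F : Set G.edgeSet) x y)

theorem measurableSet_setOf_mem_openCluster_mask [Countable G.edgeSet] (S : Set G.edgeSet)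
    (x y : V) : MeasurableSet {ω : G.edgeSet → Bool | y ∈ openCluster (mask S ω) x} :=
  measurable_mask S (measurableSet_setOf_mem_openCluster x y)

theorem measurableSet_setOf_openCluster_eq [Countable V] (x : V) (A : Set V) :
    MeasurableSet {ω : G.edgeSet → Bool | openCluster ω x = A} := by
  simp only [Set.ext_iff, Set.ofPred_forall]
  refine .iInter fun y => ?_
  by_cases hy : y ∈ A
  · simpa only [hy, iff_true] using measurableSet_setOf_mem_openCluster x y
  · simp only [hy, iff_false]
    exact (measurableSet_setOf_mem_openCluster x y).compl

variable (G) in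
/-- The edges of `G` with both endpoints in `S`. In particular `edgesWithin G Sᶜ` consists of the
edges which do not touch `S`. -/
def edgesWithin (S : Set V) : Set G.edgeSet := {e | ∀ v ∈ (e : Sym2 V), v ∈ S}

theorem dartEdge_mem_edgesWithin {S : Set V} {a : G.Dart} :
    dartEdge a ∈ edgesWithin G S ↔ a.fst ∈ S ∧ a.snd ∈ S := by
  simp [edgesWithin, mem_dartEdge]

theorem preimage_mapEdgeSet_edgesWithin {V' : Type*} {G' : SimpleGraph V'} (φ : G ≃g G')
    (S : Set V') : φ.mapEdgeSet ⁻¹' edgesWithin G' S = edgesWithin G (φ ⁻¹' S) := by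
  ext ⟨e, he⟩
  simp [edgesWithin, Sym2.mem_map]

theorem openCluster_mask_edgesWithin_subset {S : Set V} (hx : x ∈ S) (ω : G.edgeSet → Bool) :
    openCluster (mask (edgesWithin G S) ω) x ⊆ S := fun _ hy =>
  openCluster_induction (P := (· ∈ S)) hx
    (fun _ ha _ _ => (dartEdge_mem_edgesWithin.1 (mask_eq_true.1 ha).1).2) hy

theorem openCluster_eq_of_eqOn_compl_edgesWithin
    (h : Set.EqOn ω ω' (edgesWithin G (openCluster ω x)ᶜ)ᶜ) :
    openCluster ω' x = openCluster ω x := by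
  have htouch : ∀ a : G.Dart, a.fst ∈ openCluster ω x → ω (dartEdge a) = ω' (dartEdge a) :=
    fun a ha => h fun he => (dartEdge_mem_edgesWithin.1 he).1 ha
  refine Set.Subset.antisymm (fun y hy => ?_) (fun y hy => ?_)
  · refine openCluster_induction (P := (· ∈ openCluster ω x)) (self_mem_openCluster ω x) ?_ hy
    exact fun a ha _ hfst => snd_mem_openCluster hfst ((htouch a hfst).trans ha)
  · refine openCluster_induction (P := (· ∈ openCluster ω' x)) (self_mem_openCluster ω' x) ?_ hy
    exact fun a ha hfst hfst' => snd_mem_openCluster hfst' ((htouch a hfst).symm.trans ha)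

theorem dependsOn_openCluster_eq (x : V) (A : Set V) :
    DependsOn (· ∈ {ω : G.edgeSet → Bool | openCluster ω x = A}) (edgesWithin G Aᶜ)ᶜ :=
  fun ω ω' h => by
    refine propext ⟨?_, ?_⟩
    · rintro rfl
      exact openCluster_eq_of_eqOn_compl_edgesWithin h
    · rintro rfl
      exact openCluster_eq_of_eqOn_compl_edgesWithin fun e he => (h e he).symm

/- The witness is the last dart along an open path in `ω ⊔ η` to leave the cluster of `ω`: beyond it
the path never touches that cluster again. -/
theorem exists_exit_dart (ω η : G.edgeSet → Bool) (hy : y ∈ openCluster (ω ⊔ η) x)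
    (hyω : y ∉ openCluster ω x) : ∃ a : G.Dart, a.fst ∈ openCluster ω x ∧ η (dartEdge a) = true ∧
      y ∈ openCluster (mask (edgesWithin G (openCluster ω x)ᶜ) (ω ⊔ η)) a.snd := by
  refine openCluster_induction (P := fun y => y ∉ openCluster ω x → ∃ a : G.Dart,
    a.fst ∈ openCluster ω x ∧ η (dartEdge a) = true ∧
      y ∈ openCluster (mask (edgesWithin G (openCluster ω x)ᶜ) (ω ⊔ η)) a.snd)
    (fun hx => absurd (self_mem_openCluster ω x) hx) (fun a ha _ ih hsnd => ?_) hy hyω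
  by_cases hfst : a.fst ∈ openCluster ω x
  · have hopen : ω (dartEdge a) = true ∨ η (dartEdge a) = true := Bool.or_eq_true_iff.1 ha
    exact ⟨a, hfst, hopen.resolve_left fun h => hsnd (snd_mem_openCluster hfst h),
      self_mem_openCluster _ _⟩
  · obtain ⟨b, hb, hη, hreach⟩ := ih hfst
    exact ⟨b, hb, hη, snd_mem_openCluster hreach
      (mask_eq_true.2 ⟨dartEdge_mem_edgesWithin.2 ⟨hfst, hsnd⟩, ha⟩)⟩

theorem mem_openCluster_comp_mapEdgeSet {V' : Type*} {G' : SimpleGraph V'} (φ : G ≃g G')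
    (ω : G'.edgeSet → Bool) (x y : V) :
    y ∈ openCluster (ω ∘ φ.mapEdgeSet) x ↔ φ y ∈ openCluster ω (φ x) := by
  let ψ : openSubgraph (ω ∘ φ.mapEdgeSet) ≃g openSubgraph ω :=
    { φ.toEquiv with
      map_rel_iff' := ⟨fun ⟨hadj, hω⟩ => ⟨φ.map_rel_iff.1 hadj, hω⟩,
        fun ⟨hadj, hω⟩ => ⟨φ.map_rel_iff.2 hadj, hω⟩⟩ }
  exact (SimpleGraph.Iso.reachable_iff (φ := ψ)).symm

end OpenCluster

section MeanSize

variable {V : Type*} {G : SimpleGraph V} {r r' : G.edgeSet → I} {x y : V}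

/-- The probability that `x` and `y` are joined by open edges, in bond percolation on `G` with
inhomogeneous edge parameters `r`. -/
def connProb (r : G.edgeSet → I) (x y : V) : ℝ≥0∞ :=
  bernoulliProduct r {ω | y ∈ openCluster ω x}

/-- The mean size of the open cluster of `x`, written as the sum of the connection probabilities
(see `lintegral_encard_openCluster`). -/
def meanSize (r : G.edgeSet → I) (x : V) : ℝ≥0∞ := ∑' y, connProb r x y

theorem connProb_le_one (r : G.edgeSet → I) (x y : V) : connProb r x y ≤ 1 := prob_le_one

theorem connProb_comm (r : G.edgeSet → I) (x y : V) : connProb r x y = connProb r y x := by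
  simp only [connProb, mem_openCluster_comm (x := x)]

variable [Countable V]

theorem lintegral_encard_openCluster (r : G.edgeSet → I) (x : V) :
    ∫⁻ ω, ((openCluster ω x).encard : ℝ≥0∞) ∂(bernoulliProduct r) = meanSize r x := by
  have hcount (ω : G.edgeSet → Bool) : ((openCluster ω x).encard : ℝ≥0∞) =
      ∑' y, {ω | y ∈ openCluster ω x}.indicator (fun _ => 1) ω :=
    (ENNReal.tsum_set_one (openCluster ω x)).symm.trans (tsum_subtype (openCluster ω x) 1)
  simp only [hcount]
  rw [lintegral_tsum fun y =>
    (measurable_const.indicator (measurableSet_setOf_mem_openCluster x y)).aemeasurable]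
  exact tsum_congr fun y => lintegral_indicator_one (measurableSet_setOf_mem_openCluster x y)

theorem connProb_mono (h : r ≤ r') (x y : V) : connProb r x y ≤ connProb r' x y := by
  choose ε hε using fun e => exists_orProb_eq (h e)
  obtain rfl : (fun e => orProb (r e) (ε e)) = r' := funext hε
  have hmeas := measurableSet_setOf_mem_openCluster (G := G) x y
  calc connProb r x y
      = bernoulliProduct (Sum.elim r ε) {ζ | y ∈ openCluster (ζ ∘ Sum.inl) x} :=
        ((measurePreserving_inl_bernoulliProduct r ε).measure_preimage hmeas.nullMeasurableSet).symm
    _ ≤ bernoulliProduct (Sum.elim r ε) {ζ | y ∈ openCluster (ζ ∘ Sum.inl ⊔ ζ ∘ Sum.inr) x} :=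
        measure_mono fun ζ hζ => openCluster_mono le_sup_left x hζ
    _ = connProb (fun e => orProb (r e) (ε e)) x y :=
        (measurePreserving_sup_bernoulliProduct r ε).measure_preimage hmeas.nullMeasurableSet

theorem meanSize_mono (h : r ≤ r') (x : V) : meanSize r x ≤ meanSize r' x :=
  ENNReal.tsum_le_tsum fun y => connProb_mono h x y

theorem connProb_indicator (r : G.edgeSet → I) (S : Set G.edgeSet) (x y : V) :
    connProb (S.indicator r) x y = bernoulliProduct r {ω | y ∈ openCluster (mask S ω) x} :=
  ((measurePreserving_mask r S).measure_preimage
    (measurableSet_setOf_mem_openCluster x y).nullMeasurableSet).symm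

theorem connProb_indicator_edgesWithin_eq_zero (r : G.edgeSet → I) {S : Set V} (hx : x ∈ S)
    (hy : y ∉ S) : connProb ((edgesWithin G S).indicator r) x y = 0 := by
  rw [connProb_indicator]
  convert measure_empty (μ := bernoulliProduct r)
  exact Set.eq_empty_of_forall_notMem fun ω hω =>
    hy (openCluster_mask_edgesWithin_subset hx ω hω)

theorem meanSize_indicator_edgesWithin_le (r : G.edgeSet → I) {S : Set V} (hx : x ∈ S) :
    meanSize ((edgesWithin G S).indicator r) x ≤ S.encard := by
  rw [← ENNReal.tsum_set_one, tsum_subtype S fun _ => 1]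
  refine ENNReal.tsum_le_tsum fun y => ?_
  by_cases hy : y ∈ S
  · simpa only [Set.indicator_of_mem hy] using connProb_le_one _ x y
  · rw [connProb_indicator_edgesWithin_eq_zero r hx hy]
    exact zero_le

theorem exists_forall_meanSize_indicator_finset_le (r : G.edgeSet → I) (F : Finset G.edgeSet) :
    ∃ N : ℕ, ∀ x, meanSize ((F : Set G.edgeSet).indicator r) x ≤ N := by
  classical
  let W : Finset V := F.biUnion fun e => (e : Sym2 V).toFinset
  refine ⟨W.card + 1, fun x => ?_⟩
  have hF : (F : Set G.edgeSet) ⊆ edgesWithin G (insert x W : Finset V) := fun e he v hv =>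
    Finset.mem_insert_of_mem (Finset.mem_biUnion.2 ⟨e, he, Sym2.mem_toFinset.2 hv⟩)
  calc meanSize ((F : Set G.edgeSet).indicator r) x
      ≤ meanSize ((edgesWithin G (insert x W : Finset V)).indicator r) x :=
        meanSize_mono (Set.indicator_le_indicator_of_subset hF fun _ => unitInterval.nonneg _) x
    _ ≤ ((insert x W : Finset V) : Set V).encard :=
        meanSize_indicator_edgesWithin_le r (Finset.mem_insert_self x W)
    _ ≤ (W.card + 1 : ℕ) := by
        rw [Set.encard_coe_eq_coe_finsetCard, ENat.toENNReal_coe]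
        exact_mod_cast Finset.card_insert_le x W

theorem connProb_indicator_finset_mono (r : G.edgeSet → I) (x y : V) :
    Monotone fun F : Finset G.edgeSet => connProb ((F : Set G.edgeSet).indicator r) x y :=
  fun _ _ hFF' => connProb_mono (Set.indicator_le_indicator_of_subset (Finset.coe_subset.2 hFF')
    fun _ => unitInterval.nonneg _) x y

theorem connProb_eq_iSup_finset (r : G.edgeSet → I) (x y : V) :
    connProb r x y = ⨆ F : Finset G.edgeSet, connProb ((F : Set G.edgeSet).indicator r) x y := by
  have hmono : Monotone fun F : Finset G.edgeSet =>
      {ω : G.edgeSet → Bool | y ∈ openCluster (mask F ω) x} := fun F F' hFF' ω =>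
    (openCluster_mono (mask_mono_left (Finset.coe_subset.2 hFF') ω) x ·)
  simp only [connProb_indicator]
  rw [connProb, setOf_mem_openCluster_eq_iUnion]
  exact hmono.directed_le.measure_iUnion

theorem meanSize_le_of_forall_finset {K : ℝ≥0∞}
    (h : ∀ F : Finset G.edgeSet, meanSize ((F : Set G.edgeSet).indicator r) x ≤ K) :
    meanSize r x ≤ K := by
  rw [meanSize, ENNReal.tsum_eq_iSup_sum]
  refine iSup_le fun A => ?_
  simp only [connProb_eq_iSup_finset r]
  rw [ENNReal.finsetSum_iSup_of_monotone (connProb_indicator_finset_mono r x)]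
  exact iSup_le fun F => (ENNReal.sum_le_tsum A).trans (h F)

section Iso

variable {V' : Type*} {G' : SimpleGraph V'}

theorem connProb_comp_mapEdgeSet (φ : G ≃g G') (r : G'.edgeSet → I) (x y : V) :
    connProb (r ∘ φ.mapEdgeSet) x y = connProb r (φ x) (φ y) := by
  have hφ := measurePreserving_comp_bernoulliProduct r φ.mapEdgeSet.injective
  rw [connProb, ← hφ.measure_preimage (measurableSet_setOf_mem_openCluster x y).nullMeasurableSet]
  exact congrArg (bernoulliProduct r) (Set.ext fun ω => mem_openCluster_comp_mapEdgeSet φ ω x y)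

theorem meanSize_comp_mapEdgeSet (φ : G ≃g G') (r : G'.edgeSet → I) (x : V) :
    meanSize (r ∘ φ.mapEdgeSet) x = meanSize r (φ x) := by
  rw [meanSize, meanSize, ← φ.toEquiv.tsum_eq (connProb r (φ x))]
  exact tsum_congr (connProb_comp_mapEdgeSet φ r x)

end Iso

end MeanSize

section Exploration

variable {V : Type*} {G : SimpleGraph V} [Countable V] (r ε : G.edgeSet → I)

/- Given that the cluster of `x` is `A`, the configuration has been explored only on the edges that
touch `A`, so that an extra edge leaving `A` and the configuration off `A` are still independent. -/
theorem bernoulliProduct_openCluster_eq_inter_exit_le {A : Set V} {a : G.Dart} (ha : a.fst ∈ A)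
    (x y : V) :
    bernoulliProduct (Sum.elim r ε) ({ζ | openCluster (ζ ∘ Sum.inl) x = A} ∩
        {ζ | ζ (Sum.inr (dartEdge a)) = true} ∩
        {ζ | y ∈ openCluster (mask (edgesWithin G Aᶜ) (ζ ∘ Sum.inl ⊔ ζ ∘ Sum.inr)) a.snd}) ≤
      bernoulliProduct r {ω | openCluster ω x = A} * ENNReal.ofReal (ε (dartEdge a)) *
        connProb (fun e => orProb (r e) (ε e)) a.snd y := by
  have hinl := measurePreserving_inl_bernoulliProduct r ε
  have hsup := measurePreserving_sup_bernoulliProduct r ε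
  have hcluster := measurableSet_setOf_openCluster_eq (G := G) x A
  have hreach := measurableSet_setOf_mem_openCluster_mask (edgesWithin G Aᶜ) a.snd y
  have hedge : MeasurableSet {ζ : G.edgeSet ⊕ G.edgeSet → Bool | ζ (.inr (dartEdge a)) = true} :=
    measurable_pi_apply (X := fun _ => Bool) _ (measurableSet_singleton true)
  have hdep₁ := dependsOn_comp_inl (dependsOn_openCluster_eq (G := G) x A)
  have hdep₂ : DependsOn
      (· ∈ {ζ : G.edgeSet ⊕ G.edgeSet → Bool | ζ (.inr (dartEdge a)) = true})
      {.inr (dartEdge a)} := fun _ _ h => congrArg (· = true) (h _ rfl)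
  have hdep₃ := dependsOn_sup_inl_inr
    (dependsOn_mem_openCluster_mask (edgesWithin G Aᶜ) a.snd y)
  have hdisj₁₂ : Disjoint (Sum.inl '' (edgesWithin G Aᶜ)ᶜ) {Sum.inr (dartEdge a)} := by
    simp
  have hdisj₃ : Disjoint (Sum.inl '' (edgesWithin G Aᶜ)ᶜ ∪ {Sum.inr (dartEdge a)})
      (Sum.elim id id ⁻¹' edgesWithin G Aᶜ) := by
    refine Set.disjoint_left.2 ?_
    rintro _ (⟨e, he, rfl⟩ | rfl) h
    · exact he h
    · exact (dartEdge_mem_edgesWithin.1 h).1 ha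
  have hfactor := infinitePi_inter_of_dependsOn
    (fun i => bernoulliMeasure true false (Sum.elim r ε i)) hdisj₃
    ((hinl.measurable hcluster).inter hedge) (hsup.measurable hreach)
    (dependsOn_mem_inter hdep₁ hdep₂) hdep₃
  rw [infinitePi_inter_of_dependsOn _ hdisj₁₂ (hinl.measurable hcluster) hedge hdep₁ hdep₂]
    at hfactor
  refine hfactor.le.trans (mul_le_mul' (mul_le_mul' ?_ ?_) ?_)
  · exact (hinl.measure_preimage hcluster.nullMeasurableSet).le
  · exact (bernoulliProduct_setOf_apply_eq_true _ _).le
  · exact (hsup.measure_preimage hreach.nullMeasurableSet).trans_le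
      (measure_mono fun ω hω => openCluster_mono (mask_le _ ω) _ hω)

theorem tsum_bernoulliProduct_openCluster_eq_le (x z : V) :
    ∑' A : Finset V, (A : Set V).indicator
      (fun _ => bernoulliProduct r {ω | openCluster ω x = A}) z ≤ connProb r x z := by
  have hindicator (A : Finset V) : (A : Set V).indicator
      (fun _ => bernoulliProduct r {ω | openCluster ω x = A}) z =
      bernoulliProduct r {ω | z ∈ A ∧ openCluster ω x = A} := by
    by_cases hz : z ∈ A <;> simp [hz]
  simp only [hindicator]
  rw [← measure_iUnion]
  · refine measure_mono (Set.iUnion_subset fun A ω ⟨hz, hω⟩ => ?_)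
    exact (Set.ext_iff.1 hω z).2 hz
  · exact fun A B hAB => Set.disjoint_left.2 fun ω hA hB =>
      hAB (Finset.coe_injective (hA.2.symm.trans hB.2))
  · exact fun A => (MeasurableSet.const _).inter (measurableSet_setOf_openCluster_eq x A)

theorem ae_finite_openCluster {r : G.edgeSet → I} {x : V} (hx : meanSize r x ≠ ∞) :
    ∀ᵐ ω ∂(bernoulliProduct r), (openCluster ω x).Finite :=
  ae_finite_setOfPred_mem hx

theorem bernoulliProduct_exit_dart_le {x : V} (hx : meanSize r x ≠ ∞) (y : V) (a : G.Dart) :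
    bernoulliProduct (Sum.elim r ε) {ζ | a.fst ∈ openCluster (ζ ∘ Sum.inl) x ∧
        ζ (Sum.inr (dartEdge a)) = true ∧
        y ∈ openCluster (mask (edgesWithin G (openCluster (ζ ∘ Sum.inl) x)ᶜ)
          (ζ ∘ Sum.inl ⊔ ζ ∘ Sum.inr)) a.snd} ≤
      connProb r x a.fst * ENNReal.ofReal (ε (dartEdge a)) *
        connProb (fun e => orProb (r e) (ε e)) a.snd y := by
  let exitFrom (A : Finset V) : Set (G.edgeSet ⊕ G.edgeSet → Bool) :=
    {ζ | openCluster (ζ ∘ Sum.inl) x = A} ∩ {ζ | ζ (Sum.inr (dartEdge a)) = true} ∩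
      {ζ | y ∈ openCluster (mask (edgesWithin G (A : Set V)ᶜ) (ζ ∘ Sum.inl ⊔ ζ ∘ Sum.inr)) a.snd}
  have hfinite := (measurePreserving_inl_bernoulliProduct r ε).quasiMeasurePreserving.ae
    (ae_finite_openCluster hx)
  calc _ ≤ bernoulliProduct (Sum.elim r ε) (⋃ A : Finset V, {ζ | a.fst ∈ A ∧ ζ ∈ exitFrom A}) := by
        refine measure_mono_ae ?_
        filter_upwards [hfinite] with ζ hζ ⟨hfst, hopen, hreach⟩
        refine Set.mem_iUnion.2 ⟨hζ.toFinset, hζ.mem_toFinset.2 hfst, ⟨?_, hopen⟩, ?_⟩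
        · exact hζ.coe_toFinset.symm
        · simpa only [Set.mem_ofPred_eq, hζ.coe_toFinset] using hreach
    _ ≤ ∑' A : Finset V, bernoulliProduct (Sum.elim r ε) {ζ | a.fst ∈ A ∧ ζ ∈ exitFrom A} :=
        measure_iUnion_le _
    _ ≤ ∑' A : Finset V, (A : Set V).indicator
          (fun _ => bernoulliProduct r {ω | openCluster ω x = A}) a.fst *
            (ENNReal.ofReal (ε (dartEdge a)) *
              connProb (fun e => orProb (r e) (ε e)) a.snd y) := by
        refine ENNReal.tsum_le_tsum fun A => ?_
        by_cases ha : a.fst ∈ A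
        · simp only [ha, true_and, Set.indicator_of_mem (Finset.mem_coe.2 ha), ← mul_assoc]
          exact bernoulliProduct_openCluster_eq_inter_exit_le r ε (Finset.mem_coe.2 ha) x y
        · simp [ha]
    _ ≤ _ := by
        rw [ENNReal.tsum_mul_right, mul_assoc]
        exact mul_le_mul_left (tsum_bernoulliProduct_openCluster_eq_le r x a.fst) _

theorem connProb_orProb_le {x : V} (hx : meanSize r x ≠ ∞) (y : V) :
    connProb (fun e => orProb (r e) (ε e)) x y ≤ connProb r x y +
      ∑' a : G.Dart, connProb r x a.fst * ENNReal.ofReal (ε (dartEdge a)) *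
        connProb (fun e => orProb (r e) (ε e)) a.snd y := by
  have hinl := measurePreserving_inl_bernoulliProduct r ε
  have hsup := measurePreserving_sup_bernoulliProduct r ε
  have hmeas := (measurableSet_setOf_mem_openCluster (G := G) x y)
  have : Countable G.Dart := SimpleGraph.Dart.toProd_injective.countable
  calc connProb (fun e => orProb (r e) (ε e)) x y
      = bernoulliProduct (Sum.elim r ε) {ζ | y ∈ openCluster (ζ ∘ Sum.inl ⊔ ζ ∘ Sum.inr) x} :=
        (hsup.measure_preimage hmeas.nullMeasurableSet).symm
    _ ≤ bernoulliProduct (Sum.elim r ε) ({ζ | y ∈ openCluster (ζ ∘ Sum.inl) x} ∪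
          ⋃ a : G.Dart, {ζ | a.fst ∈ openCluster (ζ ∘ Sum.inl) x ∧
            ζ (Sum.inr (dartEdge a)) = true ∧
            y ∈ openCluster (mask (edgesWithin G (openCluster (ζ ∘ Sum.inl) x)ᶜ)
              (ζ ∘ Sum.inl ⊔ ζ ∘ Sum.inr)) a.snd}) :=
        measure_mono fun ζ hζ => or_iff_not_imp_left.2 fun hy =>
          Set.mem_iUnion.2 (exists_exit_dart _ _ hζ hy)
    _ ≤ _ := (measure_union_le _ _).trans (add_le_add
        (hinl.measure_preimage hmeas.nullMeasurableSet).le ((measure_iUnion_le _).trans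
          (ENNReal.tsum_le_tsum (bernoulliProduct_exit_dart_le r ε hx y))))

theorem meanSize_orProb_le {x : V} (hx : meanSize r x ≠ ∞) :
    meanSize (fun e => orProb (r e) (ε e)) x ≤ meanSize r x +
      ∑' a : G.Dart, connProb r x a.fst * ENNReal.ofReal (ε (dartEdge a)) *
        meanSize (fun e => orProb (r e) (ε e)) a.snd := by
  refine (ENNReal.tsum_le_tsum (connProb_orProb_le r ε hx)).trans_eq ?_
  simp only [ENNReal.tsum_add, meanSize, ← ENNReal.tsum_mul_left]
  rw [ENNReal.tsum_comm]

end Exploration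

theorem le_div_one_sub_of_le_add_mul {M K δ : ℝ≥0∞} (hM : M ≠ ∞) (hδ : δ < 1) (h : M ≤ K + δ * M) :
    M ≤ K / (1 - δ) := by
  rw [ENNReal.le_div_iff_mul_le (.inl (tsub_pos_of_lt hδ).ne')
    (.inl (ne_top_of_le_ne_top ENNReal.one_ne_top tsub_le_self)),
    ENNReal.mul_sub fun _ _ => hM, mul_one, tsub_le_iff_right, mul_comm M δ]
  exact h

section Decomposition

variable {V : Type*} {G : SimpleGraph V} [Countable V] {r : G.edgeSet → I} {K δ : ℝ≥0∞}

theorem meanSize_le_of_decomposition (hK : K ≠ ∞) (hδ : δ < 1) (r₀ ε : V → G.edgeSet → I)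
    (hr : ∀ x e, orProb (r₀ x e) (ε x e) = r e) (hr₀ : ∀ x, meanSize (r₀ x) x ≤ K)
    (hε : ∀ x, ∑' a : G.Dart, connProb (r₀ x) x a.fst * ENNReal.ofReal (ε x (dartEdge a)) ≤ δ)
    (x : V) : meanSize r x ≤ K / (1 - δ) := by
  refine meanSize_le_of_forall_finset fun F => ?_
  let trunc : (G.edgeSet → I) → G.edgeSet → I := (F : Set G.edgeSet).indicator
  have htrunc (f : G.edgeSet → I) : trunc f ≤ f :=
    Set.indicator_le_self' fun _ _ => unitInterval.nonneg _
  have hdecomp (x : V) : (fun e => orProb (trunc (r₀ x) e) (trunc (ε x) e)) = trunc r := by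
    funext e
    by_cases he : e ∈ (F : Set G.edgeSet)
    · simp only [trunc, Set.indicator_of_mem he, hr]
    · simp only [trunc, Set.indicator_of_notMem he, orProb_zero_left]
  let M : ℝ≥0∞ := ⨆ x, meanSize (trunc r) x
  obtain ⟨N, hN⟩ := exists_forall_meanSize_indicator_finset_le r F
  have hM : M ≠ ∞ := ne_top_of_le_ne_top (ENNReal.natCast_ne_top N) (iSup_le hN)
  have hstep (x : V) : meanSize (trunc r) x ≤ K + δ * M := by
    have hx : meanSize (trunc (r₀ x)) x ≤ K := (meanSize_mono (htrunc _) x).trans (hr₀ x)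
    have hexplore := meanSize_orProb_le (trunc (r₀ x)) (trunc (ε x)) (ne_top_of_le_ne_top hK hx)
    rw [hdecomp] at hexplore
    refine hexplore.trans (add_le_add hx ?_)
    calc _ ≤ ∑' a : G.Dart, connProb (r₀ x) x a.fst * ENNReal.ofReal (ε x (dartEdge a)) * M := by
          gcongr with a
          · exact connProb_mono (htrunc _) x a.fst
          · exact htrunc (ε x) _
          · exact le_iSup (meanSize (trunc r)) a.snd
      _ ≤ δ * M := by
          rw [ENNReal.tsum_mul_right]
          exact mul_le_mul_left (hε x) M
  exact (le_iSup (meanSize (trunc r)) x).trans (le_div_one_sub_of_le_add_mul hM hδ (iSup_le hstep))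

end Decomposition

section ExitCriterion

variable {V : Type*} {G : SimpleGraph V}

/-- The mean number of open edges through which the open cluster of `x` inside `S` can leave `S`,
where open edges have probabilities `r`. This is the quantity of the Simon–Hammersley criterion. -/
def exitMean (r : G.edgeSet → I) (S : Set V) (x : V) : ℝ≥0∞ :=
  ∑' a : G.Dart, connProb ((edgesWithin G S).indicator r) x a.fst *
    ENNReal.ofReal ((edgesWithin G S)ᶜ.indicator r (dartEdge a) : I)

variable [Countable V] {r : G.edgeSet → I} {K δ : ℝ≥0∞}

theorem exitMean_comp_mapEdgeSet_le {V' : Type*} {G' : SimpleGraph V'} (φ : G ≃g G')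
    (r : G'.edgeSet → I) (S : Set V') (x : V) :
    exitMean (r ∘ φ.mapEdgeSet) (φ ⁻¹' S) x ≤ exitMean r S (φ x) := by
  have hinj : (φ.toHom.mapDart : G.Dart → G'.Dart).Injective := fun a b hab =>
    SimpleGraph.Dart.toProd_injective ((φ.injective.prodMap φ.injective)
      (congrArg SimpleGraph.Dart.toProd hab))
  refine le_trans (ENNReal.tsum_le_tsum fun a => ?_) (ENNReal.tsum_comp_le_tsum_of_injective hinj _)
  have hinside : (edgesWithin G (φ ⁻¹' S)).indicator (r ∘ φ.mapEdgeSet) =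
      (edgesWithin G' S).indicator r ∘ φ.mapEdgeSet := by
    rw [← preimage_mapEdgeSet_edgesWithin]
    exact funext fun _ => Set.indicator_comp_right _
  have houtside : (edgesWithin G (φ ⁻¹' S))ᶜ.indicator (r ∘ φ.mapEdgeSet) =
      (edgesWithin G' S)ᶜ.indicator r ∘ φ.mapEdgeSet := by
    rw [← preimage_mapEdgeSet_edgesWithin, ← Set.preimage_compl]
    exact funext fun _ => Set.indicator_comp_right _
  rw [hinside, houtside, connProb_comp_mapEdgeSet]
  rfl

theorem meanSize_le_of_exitMean_le (hK : K ≠ ∞) (hδ : δ < 1) {S : V → Set V} (hS : ∀ x, x ∈ S x)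
    (hcard : ∀ x, (S x).encard ≤ K) (hexit : ∀ x, exitMean r (S x) x ≤ δ) (x : V) :
    meanSize r x ≤ K / (1 - δ) :=
  meanSize_le_of_decomposition hK hδ (fun x => (edgesWithin G (S x)).indicator r)
    (fun x => (edgesWithin G (S x))ᶜ.indicator r)
    (fun _ => orProb_indicator_indicator_compl _ r)
    (fun x => (meanSize_indicator_edgesWithin_le r (hS x)).trans (hcard x)) hexit x

theorem connProb_mul_le_connProb_snd {r₀ : G.edgeSet → I} (h : r₀ ≤ r) (x : V) {a : G.Dart}
    (ha : r₀ (dartEdge a) = 0) :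
    connProb r₀ x a.fst * ENNReal.ofReal (r (dartEdge a)) ≤ connProb r x a.snd := by
  let E : Set G.edgeSet := {dartEdge a}ᶜ
  have hr₀ : r₀ ≤ E.indicator r := fun e => by
    rcases eq_or_ne e (dartEdge a) with rfl | he
    · exact ha.trans_le (unitInterval.nonneg _)
    · exact (h e).trans_eq (Set.indicator_of_mem (s := E) he r).symm
  have hindep := infinitePi_inter_of_dependsOn (fun e => bernoulliMeasure true false (r e))
    (disjoint_compl_left (a := {dartEdge a})) (measurableSet_setOf_mem_openCluster_mask E x a.fst)
    (measurable_pi_apply (X := fun _ => Bool) (dartEdge a) (measurableSet_singleton true))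
    (dependsOn_mem_openCluster_mask E x a.fst) (fun _ _ hω => congrArg (· = true) (hω _ rfl))
  calc connProb r₀ x a.fst * ENNReal.ofReal (r (dartEdge a))
      ≤ bernoulliProduct r {ω | a.fst ∈ openCluster (mask E ω) x} *
          bernoulliProduct r {ω | ω (dartEdge a) = true} := by
        rw [← connProb_indicator, bernoulliProduct_setOf_apply_eq_true]
        exact mul_le_mul_left (connProb_mono hr₀ x a.fst) _
    _ = bernoulliProduct r ({ω | a.fst ∈ openCluster (mask E ω) x} ∩
          {ω | ω (dartEdge a) = true}) := hindep.symm
    _ ≤ connProb r x a.snd := measure_mono fun ω hω =>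
        snd_mem_openCluster (openCluster_mono (mask_le E ω) x hω.1) hω.2

end ExitCriterion

theorem tsum_ite_eq_le_of_injective {ι α : Type*} [DecidableEq α] {f : ι → α} (hf : f.Injective)
    (b : α) (c : ℝ≥0∞) : ∑' i, (if f i = b then c else 0) ≤ c :=
  (ENNReal.tsum_comp_le_tsum_of_injective hf fun a => if a = b then c else 0).trans_eq
    (tsum_ite_eq b fun _ => c)

theorem exists_pos_mul_ofReal_lt_one {A : ℝ≥0∞} (hA : A ≠ ∞) :
    ∃ c : I, 0 < c ∧ A * ENNReal.ofReal c < 1 := by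
  obtain ⟨c, hc, hcA⟩ := ENNReal.exists_nnreal_pos_mul_lt hA one_ne_zero
  refine ⟨⟨min c 1, by positivity, min_le_right _ _⟩, ?_, ?_⟩
  · exact lt_min (NNReal.coe_pos.2 hc) one_pos
  · rw [mul_comm]
    refine lt_of_le_of_lt (mul_le_mul_left ?_ A) hcA
    exact (ENNReal.ofReal_le_ofReal (min_le_left _ _)).trans_eq (ENNReal.ofReal_coe_nnreal)

section BoundedDegree

variable {V : Type*} {G : SimpleGraph V} {D : ℕ} (hD : ∀ x, (G.neighborSet x).encard ≤ D)
include hD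

theorem tsum_dart_fst_le (f : V → ℝ≥0∞) : ∑' a : G.Dart, f a.fst ≤ D * ∑' x, f x := by
  let dartEquiv : G.Dart ≃ Σ x, G.neighborSet x :=
    ⟨fun a => ⟨a.fst, a.snd, a.adj⟩, fun b => ⟨(b.1, b.2), b.2.2⟩, fun _ => rfl, fun _ => rfl⟩
  calc ∑' a : G.Dart, f a.fst
      = ∑' b : Σ x, G.neighborSet x, f b.1 := dartEquiv.tsum_eq fun b => f b.1
    _ = ∑' x, (G.neighborSet x).encard * f x := by
        rw [ENNReal.tsum_sigma']
        exact tsum_congr fun x => ENNReal.tsum_set_const (G.neighborSet x) (f x)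
    _ ≤ ∑' x, D * f x := by
        gcongr with x
        exact_mod_cast hD x
    _ = D * ∑' x, f x := ENNReal.tsum_mul_left

theorem tsum_dart_snd_le (f : V → ℝ≥0∞) : ∑' a : G.Dart, f a.snd ≤ D * ∑' x, f x :=
  ((SimpleGraph.Dart.symm_involutive.toPerm _).tsum_eq fun a : G.Dart => f a.fst).trans_le
    (tsum_dart_fst_le hD f)

variable [Countable V] {r : G.edgeSet → I} {K : ℝ≥0∞}

theorem exists_pos_forall_meanSize_orProb_lt_top (hK : K ≠ ∞) (hr : ∀ x, meanSize r x ≤ K) :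
    ∃ c : I, 0 < c ∧ ∀ x, meanSize (fun e => orProb (r e) c) x < ∞ := by
  obtain ⟨c, hc, hδ⟩ :=
    exists_pos_mul_ofReal_lt_one (ENNReal.mul_ne_top (ENNReal.natCast_ne_top D) hK)
  refine ⟨c, hc, fun x => (meanSize_le_of_decomposition hK hδ (fun _ => r) (fun _ _ => c)
    (fun _ _ => rfl) hr (fun x => ?_) x).trans_lt
      (ENNReal.div_lt_top hK (tsub_pos_of_lt hδ).ne')⟩
  rw [ENNReal.tsum_mul_right]
  gcongr
  exact (tsum_dart_fst_le hD _).trans (mul_le_mul_right (hr x) _)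

theorem meanSize_le_of_forall_mem {S : Set V} {M : ℝ≥0∞} (hK : K ≠ ∞)
    (hS : ∀ x ∈ S, meanSize r x ≤ M) {x : V}
    (hx : meanSize ((edgesWithin G S)ᶜ.indicator r) x ≤ K) : meanSize r x ≤ K + D * K * M := by
  have hr (e : G.edgeSet) : orProb ((edgesWithin G S)ᶜ.indicator r e)
      ((edgesWithin G S).indicator r e) = r e := by
    simpa only [compl_compl] using orProb_indicator_indicator_compl (edgesWithin G S)ᶜ r e
  have hexplore := meanSize_orProb_le ((edgesWithin G S)ᶜ.indicator r)
    ((edgesWithin G S).indicator r) (ne_top_of_le_ne_top hK hx)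
  simp only [hr] at hexplore
  refine hexplore.trans (add_le_add hx ?_)
  calc _ ≤ ∑' a : G.Dart, connProb ((edgesWithin G S)ᶜ.indicator r) x a.fst * M := by
        refine ENNReal.tsum_le_tsum fun a => ?_
        rw [mul_assoc]
        gcongr
        by_cases ha : dartEdge a ∈ edgesWithin G S
        · exact mul_le_of_le_one_of_le (ENNReal.ofReal_le_one.2 (unitInterval.le_one _))
            (hS _ (dartEdge_mem_edgesWithin.1 ha).2)
        · simp [ha]
    _ ≤ D * K * M := by
        rw [ENNReal.tsum_mul_right]
        gcongr
        exact (tsum_dart_fst_le hD _).trans (mul_le_mul_right hx _)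

end BoundedDegree

end BondPercolation

namespace DefectPercolation

open BondPercolation

variable {d s : ℕ}

/-- Translation by `v`, as an automorphism of the hypercubic lattice. -/
def translation (v : Fin d → ℤ) : lattice d ≃g lattice d where
  toEquiv := Equiv.addRight v
  map_rel_iff' := by simp [lattice]

@[simp]
theorem translation_apply (v x : Fin d → ℤ) : translation v x = x + v := rfl

/-- The automorphism of the hypercubic lattice moving the `i`-th coordinate to position `π i`. -/
def permutation (π : Equiv.Perm (Fin d)) : lattice d ≃g lattice d where
  toEquiv := π.arrowCongr (Equiv.refl ℤ)
  map_rel_iff' {x y} := by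
    simp only [lattice, Equiv.arrowCongr_apply, Equiv.coe_refl, Function.comp_apply, id]
    rw [Equiv.sum_comp π.symm fun i => |x i - y i|]

@[simp]
theorem permutation_apply (π : Equiv.Perm (Fin d)) (x : Fin d → ℤ) (i : Fin d) :
    permutation π x i = x (π.symm i) := rfl

theorem abs_sub_le_one_of_adj {x y : Fin d → ℤ} (h : (lattice d).Adj x y) (i : Fin d) :
    |x i - y i| ≤ 1 :=
  (Finset.single_le_sum (f := fun i => |x i - y i|) (fun _ _ => abs_nonneg _)
    (Finset.mem_univ i)).trans_eq h

theorem encard_neighborSet_lattice_le (x : Fin d → ℤ) :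
    ((lattice d).neighborSet x).encard ≤ (3 ^ d : ℕ) := by
  have hsub : (lattice d).neighborSet x ⊆ Finset.Icc (x - 1) (x + 1) := fun y hy => by
    have hdist (i : Fin d) := abs_le.1 (abs_sub_le_one_of_adj hy i)
    refine Finset.mem_coe.2 (Finset.mem_Icc.2 ⟨fun i => ?_, fun i => ?_⟩)
    · exact sub_le_comm.1 (hdist i).2
    · exact neg_le_sub_iff_le_add.1 (hdist i).1
  have hcard : (Finset.Icc (x - 1) (x + 1)).card = 3 ^ d := by
    have hinterval (i : Fin d) : x i + 1 + 1 - (x i - 1) = 3 := by ring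
    simp [Pi.card_Icc, hinterval]
  calc _ ≤ ((Finset.Icc (x - 1) (x + 1) : Finset _) : Set (Fin d → ℤ)).encard :=
        Set.encard_le_encard hsub
    _ = (3 ^ d : ℕ) := by rw [Set.encard_coe_eq_coe_finsetCard, hcard]

/-- The box `[-n, n]^d`. -/
def box (d n : ℕ) : Finset (Fin d → ℤ) := Finset.Icc (fun _ => -n) fun _ => n

theorem mem_box {n : ℕ} {x : Fin d → ℤ} : x ∈ box d n ↔ ∀ i, |x i| ≤ n := by
  simp only [box, Finset.mem_Icc, Pi.le_def, abs_le, forall_and]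

theorem exists_abs_snd_eq_of_exit_box {n : ℕ} {a : (lattice d).Dart} (hfst : a.fst ∈ box d n)
    (hsnd : a.snd ∉ box d n) : ∃ i, |a.snd i| = n + 1 := by
  simp only [mem_box, not_forall, not_le] at hfst hsnd
  obtain ⟨i, hi⟩ := hsnd
  have hstep : |a.snd i - a.fst i| ≤ 1 := abs_sub_le_one_of_adj a.adj.symm i
  refine ⟨i, le_antisymm ?_ hi⟩
  linarith [hfst i, abs_sub_abs_le_abs_sub (a.snd i) (a.fst i)]

theorem edgeParam_of_mem_of_notMem (p q : I) {e : Edge d} {v : Fin d → ℤ}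
    (hv : v ∈ (e : Sym2 (Fin d → ℤ))) (hvs : v ∉ sublattice d s) : edgeParam d s p q e = p :=
  if_neg fun he => hvs (he v hv)

theorem connProb_const_mul_le_connProb_edgeParam (p q : I) {φ : lattice d ≃g lattice d}
    {S : Set (Fin d → ℤ)} (hφ : ∀ y ∈ S, φ y ∉ sublattice d s) (x : Fin d → ℤ)
    {a : (lattice d).Dart} (hfst : a.fst ∈ S) (hsnd : a.snd ∉ S) :
    connProb ((edgesWithin (lattice d) S).indicator fun _ => p) x a.fst * ENNReal.ofReal p ≤
      connProb (edgeParam d s p q) (φ x) (φ a.snd) := by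
  let r : Edge d → I := edgeParam d s p q ∘ φ.mapEdgeSet
  have hr {e : Edge d} {v : Fin d → ℤ} (hv : v ∈ (e : Sym2 (Fin d → ℤ))) (hvS : v ∈ S) : r e = p :=
    edgeParam_of_mem_of_notMem p q (Sym2.mem_map.2 ⟨v, hv, rfl⟩) (hφ v hvS)
  have hle : (edgesWithin (lattice d) S).indicator (fun _ => p) ≤ r :=
    Set.indicator_le' (fun e he => (hr (Sym2.out_fst_mem _) (he _ (Sym2.out_fst_mem _))).ge)
      fun _ _ => unitInterval.nonneg _
  have hexit := connProb_mul_le_connProb_snd hle x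
    (Set.indicator_of_notMem (fun ha => hsnd (dartEdge_mem_edgesWithin.1 ha).2) _)
  rwa [hr (mem_dartEdge.2 (.inl rfl)) hfst, connProb_comp_mapEdgeSet] at hexit

/- The box is moved so that the endpoint of the exiting dart becomes the origin and the direction of
exit becomes transversal to the sublattice, which the box then misses. -/
theorem connProb_box_mul_le_connProb_edgeParam (p q : I) {j : Fin d} (hj : s ≤ j) {n : ℕ}
    {a : (lattice d).Dart} (hfst : a.fst ∈ box d n) {i : Fin d} (hi : |a.snd i| = n + 1) :
    connProb ((edgesWithin (lattice d) (box d n)).indicator fun _ => p) 0 a.fst *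
        ENNReal.ofReal p ≤
      connProb (edgeParam d s p q) 0 (permutation (Equiv.swap i j) (-a.snd)) := by
  let φ : lattice d ≃g lattice d :=
    (translation (-a.snd)).trans (permutation (Equiv.swap i j))
  have hφ (y : Fin d → ℤ) : φ y j = y i - a.snd i := by
    simp [φ, sub_eq_add_neg]
  have hmiss : ∀ y ∈ (box d n : Set (Fin d → ℤ)), φ y ∉ sublattice d s := fun y hy hys => by
    have hyi : y i = a.snd i := sub_eq_zero.1 ((hφ y).symm.trans (hys j hj))
    have := mem_box.1 hy i
    rw [hyi, hi] at this
    linarith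
  have hsnd : a.snd ∉ box d n := fun h => by linarith [mem_box.1 h i]
  have hφ₀ : φ 0 = permutation (Equiv.swap i j) (-a.snd) :=
    congrArg (permutation (Equiv.swap i j)) (zero_add (-a.snd))
  have hφsnd : φ a.snd = 0 :=
    congrArg (permutation (Equiv.swap i j)) (add_neg_cancel a.snd)
  have hexit := connProb_const_mul_le_connProb_edgeParam p q hmiss 0 hfst hsnd
  rwa [hφ₀, hφsnd, connProb_comm (edgeParam d s p q)] at hexit

theorem exitMean_box_summand_le (p q : I) {j : Fin d} (hj : s ≤ j) (n : ℕ) (a : (lattice d).Dart) :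
    connProb ((edgesWithin (lattice d) (box d n)).indicator fun _ => p) 0 a.fst *
        ENNReal.ofReal ((edgesWithin (lattice d) (box d n))ᶜ.indicator (fun _ => p) (dartEdge a) :
          I) ≤
      ∑ i, if (n + 1 : ℤ) = |a.snd i| then
        connProb (edgeParam d s p q) 0 (permutation (Equiv.swap i j) (-a.snd)) else 0 := by
  by_cases hfst : a.fst ∈ box d n
  · by_cases hsnd : a.snd ∈ box d n
    · have hwithin : dartEdge a ∈ edgesWithin (lattice d) (box d n) :=
        dartEdge_mem_edgesWithin.2 ⟨hfst, hsnd⟩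
      simp [hwithin]
    · obtain ⟨i, hi⟩ := exists_abs_snd_eq_of_exit_box hfst hsnd
      refine le_trans ?_ (Finset.single_le_sum (fun _ _ => zero_le) (Finset.mem_univ i))
      have hexits : dartEdge a ∈ (edgesWithin (lattice d) (box d n))ᶜ :=
        fun ha => hsnd (dartEdge_mem_edgesWithin.1 ha).2
      rw [Set.indicator_of_mem hexits, if_pos hi.symm]
      exact connProb_box_mul_le_connProb_edgeParam p q hj hfst hi
  · have h₀ : (0 : Fin d → ℤ) ∈ box d n := by simp [mem_box]
    rw [connProb_indicator_edgesWithin_eq_zero _ (Finset.mem_coe.2 h₀) hfst, zero_mul]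
    exact zero_le

theorem tsum_exitMean_box_le (hs : s < d) (p q : I) :
    ∑' n, exitMean (fun _ : Edge d => p) (box d n) 0 ≤
      d * ((3 ^ d : ℕ) * meanSize (edgeParam d s p q) 0) := by
  let j : Fin d := ⟨s, hs⟩
  have hj : s ≤ j := le_rfl
  let f (i : Fin d) (x : Fin d → ℤ) : ℝ≥0∞ :=
    connProb (edgeParam d s p q) 0 (permutation (Equiv.swap i j) (-x))
  have hf (i : Fin d) : ∑' x, f i x = meanSize (edgeParam d s p q) 0 :=
    ((Equiv.neg _).trans (permutation (Equiv.swap i j)).toEquiv).tsum_eq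
      (connProb (edgeParam d s p q) 0)
  have hinj : (fun n : ℕ => (n + 1 : ℤ)).Injective :=
    (add_left_injective 1).comp Nat.cast_injective
  calc ∑' n, exitMean (fun _ : Edge d => p) (box d n) 0
      ≤ ∑' (n : ℕ) (a : (lattice d).Dart),
          ∑ i, if (n + 1 : ℤ) = |a.snd i| then f i a.snd else 0 :=
        ENNReal.tsum_le_tsum fun n => ENNReal.tsum_le_tsum (exitMean_box_summand_le p q hj n)
    _ = ∑' a : (lattice d).Dart, ∑ i,
          ∑' n : ℕ, if (n + 1 : ℤ) = |a.snd i| then f i a.snd else 0 := by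
        rw [ENNReal.tsum_comm]
        exact tsum_congr fun a => Summable.tsum_finsetSum fun _ _ => ENNReal.summable
    _ ≤ ∑' a : (lattice d).Dart, ∑ i, f i a.snd := by
        gcongr
        exact tsum_ite_eq_le_of_injective hinj _ _
    _ = ∑ i, ∑' a : (lattice d).Dart, f i a.snd :=
        Summable.tsum_finsetSum fun _ _ => ENNReal.summable
    _ ≤ ∑ _i : Fin d, (3 ^ d : ℕ) * meanSize (edgeParam d s p q) 0 := by
        gcongr with i
        exact (tsum_dart_snd_le encard_neighborSet_lattice_le (f i)).trans_eq (congrArg _ (hf i))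
    _ = d * ((3 ^ d : ℕ) * meanSize (edgeParam d s p q) 0) := by
        rw [Finset.sum_const, Finset.card_univ, Fintype.card_fin, nsmul_eq_mul]

theorem exists_exitMean_box_lt_one (hs : s < d) {p q : I}
    (h : meanSize (edgeParam d s p q) 0 ≠ ∞) :
    ∃ n, exitMean (fun _ : Edge d => p) (box d n) 0 < 1 := by
  by_contra! hexit
  have hdiverge : ∑' n, exitMean (fun _ : Edge d => p) (box d n) 0 = ∞ :=
    top_unique ((ENNReal.tsum_const_eq_top_of_ne_zero one_ne_zero).ge.trans
      (ENNReal.tsum_le_tsum hexit))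
  have hbound := tsum_exitMean_box_le hs p q
  rw [hdiverge, top_le_iff] at hbound
  exact (by finiteness : _ ≠ ∞) hbound

theorem exists_meanSize_const_le (hs : s < d) {p q : I}
    (h : meanSize (edgeParam d s p q) 0 ≠ ∞) :
    ∃ K : ℝ≥0∞, K ≠ ∞ ∧ ∀ x, meanSize (fun _ : Edge d => p) x ≤ K := by
  obtain ⟨n, hn⟩ := exists_exitMean_box_lt_one hs h
  have hcard : ((box d n).card : ℝ≥0∞) ≠ ∞ := ENNReal.natCast_ne_top _
  refine ⟨_, ENNReal.div_ne_top hcard (tsub_pos_of_lt hn).ne', meanSize_le_of_exitMean_le hcard hn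
    (S := fun x => translation (-x) ⁻¹' box d n) (fun x => ?_) (fun x => ?_) fun x => ?_⟩
  · simp [mem_box]
  · rw [Set.encard_preimage_of_bijective (translation (-x)).bijective,
      Set.encard_coe_eq_coe_finsetCard, ENat.toENNReal_coe]
  · refine (exitMean_comp_mapEdgeSet_le (translation (-x)) (fun _ => p) (box d n) x).trans_eq ?_
    rw [translation_apply, add_neg_cancel]

theorem meanSize_edgeParam_of_mem (p q : I) {x : Fin d → ℤ} (hx : x ∈ sublattice d s) :
    meanSize (edgeParam d s p q) x = meanSize (edgeParam d s p q) 0 := by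
  have hsublattice : translation x ⁻¹' sublattice d s = sublattice d s :=
    Set.ext fun v => forall₂_congr fun i hi => by simp [hx i hi]
  have hedges (e : Edge d) :
      (translation x).mapEdgeSet e ∈ sublatticeEdges d s ↔ e ∈ sublatticeEdges d s := by
    have := preimage_mapEdgeSet_edgesWithin (translation x) (sublattice d s)
    rw [hsublattice] at this
    exact Set.ext_iff.1 this e
  have hinvariant : edgeParam d s p q ∘ (translation x).mapEdgeSet = edgeParam d s p q := by
    funext e
    classical exact if_congr (hedges e) rfl rfl
  have := meanSize_comp_mapEdgeSet (translation x) (edgeParam d s p q) 0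
  rwa [hinvariant, translation_apply, zero_add, eq_comm] at this

theorem exists_meanSize_edgeParam_le {p q : I} (h : meanSize (edgeParam d s p q) 0 ≠ ∞) :
    ∃ K : ℝ≥0∞, K ≠ ∞ ∧ ∀ x, meanSize (edgeParam d s p q) x ≤ K := by
  rcases lt_or_ge s d with hs | hs
  · obtain ⟨K, hK, hbulk⟩ := exists_meanSize_const_le hs h
    have hoff : (edgesWithin (lattice d) (sublattice d s))ᶜ.indicator (edgeParam d s p q) ≤
        fun _ => p :=
      Set.indicator_le' (fun _ he => (if_neg he).le) fun _ _ => unitInterval.nonneg _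
    exact ⟨_, by finiteness, fun x => meanSize_le_of_forall_mem encard_neighborSet_lattice_le hK
      (fun y hy => (meanSize_edgeParam_of_mem p q hy).le) ((meanSize_mono hoff x).trans (hbulk x))⟩
  · exact ⟨_, h, fun x => (meanSize_edgeParam_of_mem p q fun i hi =>
      absurd i.2 (hs.trans hi).not_gt).le⟩

theorem expectedClusterSize_eq_meanSize (d s : ℕ) (p q : I) :
    expectedClusterSize d s p q = meanSize (edgeParam d s p q) 0 :=
  lintegral_encard_openCluster _ _

theorem edgeParam_le_orProb {p p' q q' c : I} (hp : p' ≤ orProb p c) (hq : q' ≤ orProb q c) :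
    edgeParam d s p' q' ≤ fun e => orProb (edgeParam d s p q e) c := fun e => by
  simp only [edgeParam]
  split_ifs
  · exact hq
  · exact hp

end DefectPercolation

end

open DefectPercolation BondPercolation

theorem mainTheorem3 (d s : ℕ) (hs : 1 ≤ s) (hsd : s ≤ d) :
    IsOpen (DefectPercolation.subcriticalSet d s) := by
  refine isOpen_iff_mem_nhds.2 fun ⟨p, q⟩ hpq => ?_
  change expectedClusterSize d s p q < ∞ at hpq
  rw [expectedClusterSize_eq_meanSize] at hpq
  obtain ⟨K, hK, hbound⟩ := exists_meanSize_edgeParam_le hpq.ne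
  obtain ⟨c, hc, hfinite⟩ :=
    exists_pos_forall_meanSize_orProb_lt_top encard_neighborSet_lattice_le hK hbound
  filter_upwards [prod_mem_nhds (setOf_le_orProb_mem_nhds p hc) (setOf_le_orProb_mem_nhds q hc)]
    with ⟨p', q'⟩ ⟨hp, hq⟩
  change expectedClusterSize d s p' q' < ∞
  rw [expectedClusterSize_eq_meanSize]
  exact (meanSize_mono (edgeParam_le_orProb hp hq) 0).trans_lt (hfinite 0)
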